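/- Write $\omega=\sqrt{2+\sqrt2}$ and $T_2=2\pi/\omega$. Let $p,q$ be relatively prime positive integers and let $F_1,F_2:\mathbb R\times\mathbb R^4\to\mathbb R$ be functions of class $C^2$ that are periodic of period $pT_2/q$ in their first variable $\tau$. Consider the perturbed double pendulum $$\theta_1''=-2\theta_1+\theta_2+\varepsilon F_1(\tau,\theta_1,\theta_1',\theta_2,\theta_2'),\qquad \theta_2''=2\theta_1-2\theta_2+\varepsilon F_2(\tau,\theta_1,\theta_1',\theta_2,\theta_2'),\tag{1}$$ and for $(Z,W)\in\mathbb R^2$ put $$A(\tau)=-\tfrac{1}{\sqrt{4+2\sqrt2}}\bigl(Z\cos\omega\tau+W\sin\omega\tau\bigr),\quad B(\tau)=\tfrac1{\sqrt2}\bigl(-W\cos\omega\tau+Z\sin\omega\tau\bigr),$$ $$C(\tau)=\tfrac1\omega\bigl(Z\cos\omega\tau+W\sin\omega\tau\bigr),\quad D(\tau)=W\cos\omega\tau-Z\sin\omega\tau ,$$ so that $A'=B$, $C'=D$. With $\bar F_k=F_k(\tau,A(\tau),B(\tau),C(\tau),D(\tau))$ define $$\mathcal G^1(Z,W)=\int_0^{pT_2}\sin(\omega\tau)\,(-\sqrt2\,\bar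 F_1+\bar F_2)\,d\tau,\qquad \mathcal G^2(Z,W)=\int_0^{pT_2}\cos(\omega\tau)\,(-\sqrt2\,\bar F_1+\bar F_2)\,d\tau .$$ A zero $(Z_0^*,W_0^*)$ of $\mathcal G^1=\mathcal G^2=0$ is called simple if $\det\dfrac{\partial(\mathcal G^1,\mathcal G^2)}{\partial(Z,W)}(Z_0^*,W_0^*)\ne0$. Then there is $\varepsilon_0>0$ such that the following holds for every simple zero $(Z_0^*,W_0^*)\neq(0,0)$. The pair $(A,C)$ with $(Z,W)=(Z_0^*,W_0^*)$ is a $T_2$-periodic solution of the unperturbed system ((1) with $\varepsilon=0$), and for every $\varepsilon$ with $0<|\varepsilon|<\varepsilon_0$ there is a $pT_2$-periodic solution $(\theta_1(\tau,\varepsilon),\theta_2(\tau,\varepsilon))$ of (1) such that, as $\varepsilon\to0$, it tends to this fast-mode periodic solution run $p$ times: $(\theta_1,\theta_1',\theta_2,\theta_2')(\tau,\varepsilon)\to(A,B,C,D)(\tau)$ uniformly in $\tau\in\mathbb R$. -/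

import Mathlib

open Filter Topology

noncomputable section

namespace DoublePendulum

/-- Angular frequency `√(2 + √2)` of the fast mode. -/
def omegaFast : ℝ := Real.sqrt (2 + Real.sqrt 2)

/-- The period `T₂ = 2π / √(2 + √2)` of the fast mode. -/
def periodFast : ℝ := 2 * Real.pi / omegaFast

/-- `(θ₁, θ₂)`, defined for all times, solves
`θ₁'' = -2 θ₁ + θ₂ + ε F₁(τ, θ₁, θ₁', θ₂, θ₂')`,
`θ₂'' = 2 θ₁ - 2 θ₂ + ε F₂(τ, θ₁, θ₁', θ₂, θ₂')`. -/
structure IsSolution (F₁ F₂ : ℝ × ℝ × ℝ × ℝ × ℝ → ℝ) (ε : ℝ) (θ₁ θ₂ : ℝ → ℝ) : Prop where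
  differentiable_fst : Differentiable ℝ θ₁
  differentiable_snd : Differentiable ℝ θ₂
  eq_fst : ∀ τ : ℝ, HasDerivAt (deriv θ₁)
    (-2 * θ₁ τ + θ₂ τ + ε * F₁ (τ, θ₁ τ, deriv θ₁ τ, θ₂ τ, deriv θ₂ τ)) τ
  eq_snd : ∀ τ : ℝ, HasDerivAt (deriv θ₂)
    (2 * θ₁ τ - 2 * θ₂ τ + ε * F₂ (τ, θ₁ τ, deriv θ₁ τ, θ₂ τ, deriv θ₂ τ)) τ

/-- First angle `θ₁` of the fast-mode orbit with parameters `(Z, W)`. -/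
def fastA (Z W τ : ℝ) : ℝ :=
  -(1 / Real.sqrt (4 + 2 * Real.sqrt 2)) *
    (Z * Real.cos (omegaFast * τ) + W * Real.sin (omegaFast * τ))

/-- Velocity `θ₁'` along the fast-mode orbit with parameters `(Z, W)`. -/
def fastB (Z W τ : ℝ) : ℝ :=
  1 / Real.sqrt 2 * (-W * Real.cos (omegaFast * τ) + Z * Real.sin (omegaFast * τ))

/-- Second angle `θ₂` of the fast-mode orbit with parameters `(Z, W)`. -/
def fastC (Z W τ : ℝ) : ℝ :=
  1 / omegaFast * (Z * Real.cos (omegaFast * τ) + W * Real.sin (omegaFast * τ))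

/-- Velocity `θ₂'` along the fast-mode orbit with parameters `(Z, W)`. -/
def fastD (Z W τ : ℝ) : ℝ :=
  W * Real.cos (omegaFast * τ) - Z * Real.sin (omegaFast * τ)

/-- A perturbation evaluated along the fast-mode orbit with parameters `(Z, W)`. -/
def alongFast (F : ℝ × ℝ × ℝ × ℝ × ℝ → ℝ) (Z W τ : ℝ) : ℝ :=
  F (τ, fastA Z W τ, fastB Z W τ, fastC Z W τ, fastD Z W τ)

/-- The averaged map `(Z, W) ↦ (𝒢¹(Z, W), 𝒢²(Z, W))`, integrated over `[0, p T₂]`. -/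
def averaged (F₁ F₂ : ℝ × ℝ × ℝ × ℝ × ℝ → ℝ) (p : ℕ) (x : ℝ × ℝ) : ℝ × ℝ :=
  (∫ τ in (0 : ℝ)..(p * periodFast), Real.sin (omegaFast * τ) *
      (-Real.sqrt 2 * alongFast F₁ x.1 x.2 τ + alongFast F₂ x.1 x.2 τ),
   ∫ τ in (0 : ℝ)..(p * periodFast), Real.cos (omegaFast * τ) *
      (-Real.sqrt 2 * alongFast F₁ x.1 x.2 τ + alongFast F₂ x.1 x.2 τ))

/-- A zero of `G` at which `G` is differentiable with nonzero Jacobian determinant. -/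
def IsSimpleZero (G : ℝ × ℝ → ℝ × ℝ) (x : ℝ × ℝ) : Prop :=
  G x = 0 ∧ DifferentiableAt ℝ G x ∧ (fderiv ℝ G x).det ≠ 0

end DoublePendulum

end

/-! In complex mode amplitudes z₁, z₂ the system becomes z₁' = -iωz₁ + εg₁, z₂' = -iνz₂ + εg₂ with
ω² = 2 + √2 and ν² = 2 - √2. For T = pT₂ the fast mode is resonant, e^{iωT} = 1, while e^{iνT} ≠ 1
because ν/ω = √2 - 1 is irrational. Hence for ε = 0 the T-periodic solutions are exactly ι(a) = (a
e^{-iωτ}, 0) with a ∈ ℂ, a family with two real parameters.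

On continuous T-periodic functions, let N be the superposition operator x ↦ G(·, x) of the forcing,
P the resonant Fourier integral of the first component, and K a periodic solution operator of the
linear system modulo resonance. It suffices to solve x = ι(a) + εK(N(x)) and P(N(x)) = 0. The second
equation carries no factor ε, so at ε = 0 it reads P(N(ι(a))) = 0. With a = Z + iW this is (𝒢¹, 𝒢²)
= 0 up to a linear isomorphism, and a simple zero makes the linearization invertible. The implicit
function theorem then yields a branch, by `exists_branch`, `hasStrictFDerivAt_superposition` and
`exists_periodic_two_modes`. Convergence in the sup norm is convergence uniform in time. -/

noncomputable section

namespace DoublePendulum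

/-! ### Abstract bifurcation from a kernel -/

/-- **Lyapunov–Schmidt reduction.** Near a point `a₀` of the kernel of the unperturbed problem at
which the bifurcation function `a ↦ P (N (ι a))` vanishes with invertible derivative, the equations
`x = ι a + ε • K (N x)`, `P (N x) = 0` are solvable for all small `ε`. -/
theorem exists_branch {A E : Type*} [NormedAddCommGroup A] [NormedSpace ℝ A] [CompleteSpace A]
    [NormedAddCommGroup E] [NormedSpace ℝ E] [CompleteSpace E]
    (ι : A →L[ℝ] E) (K : E →L[ℝ] E) (P : E →L[ℝ] A) {N : E → E} {N' : E →L[ℝ] E} {a₀ : A}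
    (hN : HasStrictFDerivAt N N' (ι a₀)) (h₀ : P (N (ι a₀)) = 0)
    (e : A ≃L[ℝ] A) (he : ∀ a, e a = P (N' (ι a))) :
    ∃ (δ : ℝ) (a : ℝ → A) (x : ℝ → E), 0 < δ ∧
      (∀ ε, |ε| < δ → x ε = ι (a ε) + ε • K (N (x ε)) ∧ P (N (x ε)) = 0) ∧
      Tendsto x (𝓝 0) (𝓝 (ι a₀)) := by
  let f : ℝ × (A × E) → E × A := fun w =>
    (w.2.2 - ι w.2.1 - w.1 • K (N w.2.2), P (N w.2.2))
  let u : ℝ × (A × E) := (0, (a₀, ι a₀))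
  have hy : HasStrictFDerivAt (fun w : ℝ × (A × E) => N w.2.2)
      (N' ∘L (ContinuousLinearMap.snd ℝ A E ∘L ContinuousLinearMap.snd ℝ ℝ (A × E))) u :=
    HasStrictFDerivAt.comp u (f := fun w : ℝ × (A × E) => w.2.2) hN
      (ContinuousLinearMap.snd ℝ A E ∘L ContinuousLinearMap.snd ℝ ℝ (A × E)).hasStrictFDerivAt
  have h1 := (ContinuousLinearMap.snd ℝ A E ∘L
      ContinuousLinearMap.snd ℝ ℝ (A × E)).hasStrictFDerivAt (x := u)
  have h2 := (ι ∘L ContinuousLinearMap.fst ℝ A E ∘L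
      ContinuousLinearMap.snd ℝ ℝ (A × E)).hasStrictFDerivAt (x := u)
  have h3 := (hasStrictFDerivAt_fst (𝕜 := ℝ) (E := ℝ) (F := A × E) (p := u)).smul
    (K.hasStrictFDerivAt.comp u hy)
  have hf := (((h1.sub h2).sub h3).prodMk (P.hasStrictFDerivAt.comp u hy) :
    HasStrictFDerivAt f _ u)
  -- At ε = 0 the term ε • K (N' ·) drops out of the product rule; only the ε-direction still sees
  -- K.
  let f' := ((ContinuousLinearMap.snd ℝ A E ∘L ContinuousLinearMap.snd ℝ ℝ (A × E)) -
    (ι ∘L ContinuousLinearMap.fst ℝ A E ∘L ContinuousLinearMap.snd ℝ ℝ (A × E)) -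
    ContinuousLinearMap.smulRight (ContinuousLinearMap.fst ℝ ℝ (A × E)) (K (N (ι a₀)))).prod
    (P ∘L N' ∘L ContinuousLinearMap.snd ℝ A E ∘L ContinuousLinearMap.snd ℝ ℝ (A × E))
  have hf' : HasStrictFDerivAt f f' u := by
    refine hf.congr_fderiv ?_
    ext <;> simp [f', u]
  have hinv : (f' ∘L ContinuousLinearMap.inr ℝ ℝ (A × E)).IsInvertible := by
    -- To invert (b, y) ↦ (y - ι b, P (N' y)) at (r, s), substitute y = ι b + r. This leaves e b = s
    -- - P (N' r), whose solution b is `d (r, s)`.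
    let d : E × A →L[ℝ] A := (e.symm : A →L[ℝ] A) ∘L
      (ContinuousLinearMap.snd ℝ E A - P ∘L N' ∘L ContinuousLinearMap.fst ℝ E A)
    refine ContinuousLinearMap.IsInvertible.of_inverse
      (g := d.prod (ι ∘L d + ContinuousLinearMap.fst ℝ E A)) ?_ ?_
    · refine ContinuousLinearMap.ext fun w => ?_
      have hd : P (N' (ι (d w))) = w.2 - P (N' w.1) := by
        rw [← he]; simp [d]
      refine Prod.ext ?_ ?_
      · simp [f']
      · simp [f', hd]
    · refine ContinuousLinearMap.ext fun w => ?_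
      have hd : d ((f' ∘L ContinuousLinearMap.inr ℝ ℝ (A × E)) w) = w.1 := by
        simp [d, f', ← he]
      refine Prod.ext hd ?_
      simp only [ContinuousLinearMap.comp_apply, ContinuousLinearMap.prod_apply,
        add_apply] at hd ⊢
      rw [hd]
      simp [f']
  have hsol := hf'.eventually_apply_implicitFunctionOfProdDomain hinv
  have hlim := hf'.tendsto_implicitFunctionOfProdDomain hinv
  set ψ := hf'.implicitFunctionOfProdDomain hinv
  have hfu : f u = 0 := by simp [f, u, h₀]
  rw [hfu] at hsol
  obtain ⟨δ, hδ, hball⟩ := Metric.eventually_nhds_iff_ball.1 hsol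
  refine ⟨δ, fun ε => (ψ ε).1, fun ε => (ψ ε).2, hδ, fun ε hε => ?_,
    (continuous_snd.tendsto _).comp hlim⟩
  have h := hball ε (by simpa [u] using hε)
  have h1 : (ψ ε).2 - ι (ψ ε).1 - ε • K (N (ψ ε).2) = 0 := congrArg Prod.fst h
  exact ⟨by rwa [sub_sub, sub_eq_zero] at h1, congrArg Prod.snd h⟩

/-! ### Superposition operators on periodic functions -/

/-- A nonlinearity `G (τ, v)` of class `C¹` is strictly differentiable in `v` along a curve,
uniformly on compact time intervals. -/
theorem eventually_norm_sub_sub_fderiv_le {V W : Type*} [NormedAddCommGroup V] [NormedSpace ℝ V]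
    [NormedAddCommGroup W] [NormedSpace ℝ W] {G : ℝ × V → W} (hG : ContDiff ℝ 1 G)
    {x₀ : ℝ → V} (hx₀ : Continuous x₀) {K : Set ℝ} (hK : IsCompact K) {η : ℝ} (hη : 0 < η) :
    ∀ᶠ w in 𝓝 (0 : V × V), ∀ τ ∈ K,
      ‖G (τ, x₀ τ + w.1) - G (τ, x₀ τ + w.2) - fderiv ℝ G (τ, x₀ τ) (0, w.1 - w.2)‖
        ≤ η * ‖w.1 - w.2‖ := by
  -- By compactness an estimate near each τ₀ suffices. Strict differentiability at (τ₀, x₀ τ₀) costs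
  -- η/2, and replacing the derivative there by the one at (τ, x₀ τ) costs another η/2.
  refine hK.eventually_forall_of_forall_eventually fun τ₀ _ => ?_
  have hstrict := (hG.contDiffAt (x := (τ₀, x₀ τ₀))).hasStrictFDerivAt one_ne_zero
  have hb := (hasStrictFDerivAt_iff_isLittleO.1 hstrict).def (half_pos hη)
  have hD : Continuous (fun τ => fderiv ℝ G (τ, x₀ τ)) :=
    (hG.continuous_fderiv one_ne_zero).comp (by fun_prop)
  have hc := (hD.tendsto τ₀).eventually (Metric.ball_mem_nhds _ (half_pos hη))
  have hm : Tendsto (fun z : (V × V) × ℝ => ((z.2, x₀ z.2 + z.1.1), (z.2, x₀ z.2 + z.1.2)))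
      (𝓝 (0, τ₀)) (𝓝 ((τ₀, x₀ τ₀), (τ₀, x₀ τ₀))) := by
    have : Continuous
      (fun z : (V × V) × ℝ => ((z.2, x₀ z.2 + z.1.1), (z.2, x₀ z.2 + z.1.2))) := by fun_prop
    simpa using this.tendsto (0, τ₀)
  have hs : Tendsto (fun z : (V × V) × ℝ => z.2) (𝓝 (0, τ₀)) (𝓝 τ₀) :=
    continuous_snd.tendsto ((0 : V × V), τ₀)
  filter_upwards [hm.eventually hb, hs.eventually hc] with z hz1 hz2
  simp only [Prod.mk_sub_mk, sub_self, add_sub_add_left_eq_sub] at hz1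
  have hn : ‖((0 : ℝ), z.1.1 - z.1.2)‖ = ‖z.1.1 - z.1.2‖ := by simp [Prod.norm_def]
  rw [hn] at hz1
  rw [dist_comm, dist_eq_norm] at hz2
  have h3 := (fderiv ℝ G (τ₀, x₀ τ₀) - fderiv ℝ G (z.2, x₀ z.2)).le_opNorm (0, z.1.1 - z.1.2)
  rw [hn, sub_apply] at h3
  have h4 := mul_le_mul_of_nonneg_right hz2.le (norm_nonneg (z.1.1 - z.1.2))
  have h5 := norm_add_le
    (G (z.2, x₀ z.2 + z.1.1) - G (z.2, x₀ z.2 + z.1.2)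
      - fderiv ℝ G (τ₀, x₀ τ₀) (0, z.1.1 - z.1.2))
    (fderiv ℝ G (τ₀, x₀ τ₀) (0, z.1.1 - z.1.2) - fderiv ℝ G (z.2, x₀ z.2) (0, z.1.1 - z.1.2))
  rw [sub_add_sub_cancel] at h5
  linarith

section Periodic

variable {T : ℝ} {V W : Type*} [NormedAddCommGroup V] [NormedAddCommGroup W]

/-- A continuous periodic function as a continuous function on the circle. -/
def periodicLift (f : ℝ → V) (hf : Continuous f) (hp : Function.Periodic f T) :
    C(AddCircle T, V) where
  toFun := hp.lift
  continuous_toFun := hf.quotient_lift _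

theorem continuous_comp_coe (x : C(AddCircle T, V)) : Continuous fun τ : ℝ => x τ :=
  x.continuous.comp (AddCircle.continuous_mk' T)

theorem circle_ext {x y : C(AddCircle T, V)} (h : ∀ τ : ℝ, x τ = y τ) : x = y := by
  ext t
  obtain ⟨τ, rfl⟩ := QuotientAddGroup.mk_surjective t
  exact h τ

variable [hT : Fact (0 < T)]

theorem circle_norm_le {x : C(AddCircle T, V)} {C : ℝ} (hC : 0 ≤ C)
    (h : ∀ τ ∈ Set.Icc 0 T, ‖x (τ : ℝ)‖ ≤ C) : ‖x‖ ≤ C := by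
  refine (ContinuousMap.norm_le _ hC).2 fun t => ?_
  have ht : t ∈ ((↑) : ℝ → AddCircle T) '' Set.Icc 0 (0 + T) := by
    rw [AddCircle.coe_image_Icc_eq]; trivial
  obtain ⟨τ, hτ, rfl⟩ := ht
  exact h τ (by simpa using hτ)

variable [NormedSpace ℝ V] [NormedSpace ℝ W]

/-- Pointwise application of a circle of continuous linear maps. -/
def pointwiseApply (L : C(AddCircle T, V →L[ℝ] W)) : C(AddCircle T, V) →L[ℝ] C(AddCircle T, W) :=
  LinearMap.mkContinuous
    { toFun := fun v => ⟨fun t => L t (v t), L.continuous.clm_apply v.continuous⟩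
      map_add' := fun v w => by ext t; simp
      map_smul' := fun r v => by ext t; simp } ‖L‖ fun v =>
    (ContinuousMap.norm_le _ (by positivity)).2 fun t =>
      (L t).le_of_opNorm_le_of_le (L.norm_coe_le_norm t) (v.norm_coe_le_norm t)

/-- The superposition operator `x ↦ G (·, x)` on periodic functions. -/
def superposition (G : ℝ × V → W) (hG : Continuous G) (hp : ∀ τ v, G (τ + T, v) = G (τ, v))
    (x : C(AddCircle T, V)) : C(AddCircle T, W) :=
  periodicLift (fun τ => G (τ, x τ)) (hG.comp (continuous_id.prodMk (continuous_comp_coe x)))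
    fun τ => by simp [hp]

/-- The derivative is pointwise application of ∂G/∂v along x₀. One period covers the circle, so the
estimate uniform on [0, T] is the sup-norm estimate. -/
theorem hasStrictFDerivAt_superposition {G : ℝ × V → W} (hG : ContDiff ℝ 1 G)
    (hp : ∀ τ v, G (τ + T, v) = G (τ, v)) (x₀ : C(AddCircle T, V)) :
    ∃ N' : C(AddCircle T, V) →L[ℝ] C(AddCircle T, W),
      HasStrictFDerivAt (superposition (T := T) G hG.continuous hp) N' x₀ := by
  -- The derivative inherits the period of G, so the coefficient `L` descends to the circle.
  have hfp : ∀ τ v, fderiv ℝ G (τ + T, v) = fderiv ℝ G (τ, v) := fun τ v => by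
    have h := fderiv_comp_add_right (𝕜 := ℝ) (f := G) (x := (τ, v)) (T, 0)
    have hG' : (fun y : ℝ × V => G (y + (T, 0))) = G := by
      funext y
      have h := hp y.1 y.2
      rwa [show (y.1 + T, y.2) = y + (T, 0) by ext <;> simp] at h
    rw [hG'] at h
    simpa using h.symm
  let L : C(AddCircle T, V →L[ℝ] W) :=
    periodicLift (fun τ => (fderiv ℝ G (τ, x₀ τ)).comp (ContinuousLinearMap.inr ℝ ℝ V))
      (((hG.continuous_fderiv one_ne_zero).comp
        (continuous_id.prodMk (continuous_comp_coe x₀))).clm_comp continuous_const)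
      fun τ => by simp [hfp]
  refine ⟨pointwiseApply L, hasStrictFDerivAt_iff_isLittleO.2 (Asymptotics.IsLittleO.of_bound ?_)⟩
  intro η hη
  have hev := eventually_norm_sub_sub_fderiv_le hG (continuous_comp_coe x₀)
    (isCompact_Icc (a := 0) (b := T)) hη
  obtain ⟨δ, hδ, hball⟩ := Metric.eventually_nhds_iff_ball.1 hev
  refine Metric.eventually_nhds_iff_ball.2 ⟨δ, hδ, fun y hy => ?_⟩
  refine circle_norm_le (by positivity) fun τ hτ => ?_
  have hw : (y.1 (τ : AddCircle T) - x₀ τ, y.2 (τ : AddCircle T) - x₀ τ) ∈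
      Metric.ball (0 : V × V) δ := by
    rw [mem_ball_iff_norm] at hy ⊢
    rw [sub_zero]
    refine lt_of_le_of_lt ?_ hy
    exact max_le_max ((y - (x₀, x₀)).1.norm_coe_le_norm τ) ((y - (x₀, x₀)).2.norm_coe_le_norm τ)
  have h := hball _ hw τ hτ
  simp only [add_sub_cancel, sub_sub_sub_cancel_right] at h
  refine le_trans (le_of_eq ?_) (h.trans
    (mul_le_mul_of_nonneg_left ((y.1 - y.2).norm_coe_le_norm τ) hη.le))
  rfl

end Periodic

/-! ### The periodically forced linear oscillator -/

section Oscillator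

variable {T : ℝ}

/-- The rotation `exp (i μ τ)`. -/
def rot (μ τ : ℝ) : ℂ := Complex.exp ((μ * τ : ℝ) * Complex.I)

@[simp]
theorem norm_rot (μ τ : ℝ) : ‖rot μ τ‖ = 1 := Complex.norm_exp_ofReal_mul_I _

theorem rot_add (μ s t : ℝ) : rot μ (s + t) = rot μ s * rot μ t := by
  rw [rot, rot, rot, ← Complex.exp_add]
  push_cast
  ring_nf

theorem rot_neg_mul (μ τ : ℝ) : rot (-μ) τ * rot μ τ = 1 := by
  rw [rot, rot, ← Complex.exp_add]
  simp

@[fun_prop]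
theorem continuous_rot (μ : ℝ) : Continuous (rot μ) := by
  unfold rot
  fun_prop

theorem hasDerivAt_rot (μ τ : ℝ) : HasDerivAt (rot μ) (μ * Complex.I * rot μ τ) τ := by
  have h : HasDerivAt (fun τ : ℝ => ((μ * τ : ℝ) : ℂ) * Complex.I) (μ * Complex.I) τ := by
    have := (((hasDerivAt_id τ).const_mul μ).ofReal_comp).mul_const Complex.I
    simpa using this
  exact h.cexp.congr_deriv (mul_comm _ _)

theorem rot_re (μ τ : ℝ) : (rot μ τ).re = Real.cos (μ * τ) := Complex.exp_ofReal_mul_I_re _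

theorem rot_im (μ τ : ℝ) : (rot μ τ).im = Real.sin (μ * τ) := Complex.exp_ofReal_mul_I_im _

/-- The integral of `exp (i μ s) φ s` over `[0, τ]`. -/
def modeIntegral (μ : ℝ) (φ : C(AddCircle T, ℂ)) (τ : ℝ) : ℂ := ∫ s in (0 : ℝ)..τ, rot μ s * φ s

theorem continuous_rot_mul (μ : ℝ) (φ : C(AddCircle T, ℂ)) :
    Continuous fun s : ℝ => rot μ s * φ s :=
  (continuous_rot μ).mul (continuous_comp_coe φ)

theorem modeIntegral_add (μ : ℝ) (φ ψ : C(AddCircle T, ℂ)) (τ : ℝ) :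
    modeIntegral μ (φ + ψ) τ = modeIntegral μ φ τ + modeIntegral μ ψ τ := by
  simp only [modeIntegral, ContinuousMap.add_apply, mul_add]
  exact intervalIntegral.integral_add ((continuous_rot_mul μ φ).intervalIntegrable _ _)
    ((continuous_rot_mul μ ψ).intervalIntegrable _ _)

theorem modeIntegral_smul (μ r : ℝ) (φ : C(AddCircle T, ℂ)) (τ : ℝ) :
    modeIntegral μ (r • φ) τ = r • modeIntegral μ φ τ := by
  simp only [modeIntegral, ContinuousMap.smul_apply, mul_smul_comm]
  exact intervalIntegral.integral_smul _ _

theorem hasDerivAt_modeIntegral (μ : ℝ) (φ : C(AddCircle T, ℂ)) (τ : ℝ) :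
    HasDerivAt (modeIntegral μ φ) (rot μ τ * φ τ) τ :=
  (continuous_rot_mul μ φ).integral_hasStrictDerivAt 0 τ |>.hasDerivAt

/-- Split at T and translate by T: φ is periodic, while the rotation acquires the factor e^{iμT}.
This law dictates the constants that make `oscillator` periodic. -/
theorem modeIntegral_add_period (μ : ℝ) (φ : C(AddCircle T, ℂ)) (τ : ℝ) :
    modeIntegral μ φ (τ + T) = modeIntegral μ φ T + rot μ T * modeIntegral μ φ τ := by
  have hi : ∀ a b, IntervalIntegrable (fun s : ℝ => rot μ s * φ s) MeasureTheory.volume a b :=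
    fun a b => (continuous_rot_mul μ φ).intervalIntegrable a b
  rw [modeIntegral, ← intervalIntegral.integral_add_adjacent_intervals (hi 0 T) (hi T (τ + T)),
    modeIntegral, modeIntegral, ← intervalIntegral.integral_const_mul]
  congr 1
  have := intervalIntegral.integral_comp_add_right (a := 0) (b := τ)
    (fun s : ℝ => rot μ s * φ s) T
  rw [zero_add] at this
  rw [← this]
  refine intervalIntegral.integral_congr fun s _ => ?_
  simp [rot_add]
  ring

theorem norm_modeIntegral_le [Fact (0 < T)] (μ : ℝ) (φ : C(AddCircle T, ℂ)) {τ : ℝ}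
    (hτ : τ ∈ Set.Icc 0 T) : ‖modeIntegral μ φ τ‖ ≤ T * ‖φ‖ := by
  have h := intervalIntegral.norm_integral_le_of_norm_le_const (a := 0) (b := τ)
    (f := fun s : ℝ => rot μ s * φ s) (C := ‖φ‖) fun s _ => by
      simpa using φ.norm_coe_le_norm s
  rw [sub_zero, abs_of_nonneg hτ.1] at h
  calc _ ≤ ‖φ‖ * τ := h
    _ ≤ ‖φ‖ * T := mul_le_mul_of_nonneg_left hτ.2 (norm_nonneg _)
    _ = T * ‖φ‖ := mul_comm _ _

variable [hT : Fact (0 < T)]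

/-- The functional `φ ↦ ∫₀ᵀ exp (i μ s) φ s`. -/
def modeAverage (T μ : ℝ) [hT : Fact (0 < T)] : C(AddCircle T, ℂ) →L[ℝ] ℂ :=
  LinearMap.mkContinuous
    { toFun := fun φ => modeIntegral μ φ T
      map_add' := fun φ ψ => modeIntegral_add μ φ ψ T
      map_smul' := fun r φ => modeIntegral_smul μ r φ T } T fun φ =>
    norm_modeIntegral_le μ φ ⟨hT.out.le, le_rfl⟩

/-- A `T`-periodic solution operator of the forced oscillator `z' = -i μ z + φ`, up to the
resonant part of `φ`. The constants are `c = (exp (i μ T) - 1)⁻¹`, `d = 0` if there is no resonance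
and `c = 0`, `d = T⁻¹` if `exp (i μ T) = 1`. -/
def oscillator (μ : ℝ) {c d : ℂ} (hd : d * (rot μ T - 1) = 0) (hc : c + 1 - d * T = rot μ T * c) :
    C(AddCircle T, ℂ) →L[ℝ] C(AddCircle T, ℂ) :=
  LinearMap.mkContinuous
    { toFun := fun φ => periodicLift
        (fun τ => rot (-μ) τ * ((c - d * τ) * modeIntegral μ φ T + modeIntegral μ φ τ))
        (by
          have : Continuous (modeIntegral μ φ) :=
            continuous_iff_continuousAt.2 fun τ => (hasDerivAt_modeIntegral μ φ τ).continuousAt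
          fun_prop)
        (by
          intro τ
          -- A shift by T must multiply the bracket by e^{iμT}. Here `hc` matches the constant
          -- coefficients of `modeIntegral μ φ T` and `hd` those linear in τ.
          have h : rot (-μ) T * rot μ T = 1 := rot_neg_mul μ T
          simp only [modeIntegral_add_period, rot_add]
          push_cast
          linear_combination (rot (-μ) τ * rot (-μ) T * modeIntegral μ φ T) * hc +
            rot (-μ) τ * (modeIntegral μ φ τ + (c - d * τ) * modeIntegral μ φ T) * h +
            (rot (-μ) τ * rot (-μ) T * τ * modeIntegral μ φ T) * hd)
      map_add' := fun φ ψ => circle_ext fun τ => by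
        change rot (-μ) τ * ((c - d * τ) * modeIntegral μ (φ + ψ) T + modeIntegral μ (φ + ψ) τ) =
          rot (-μ) τ * ((c - d * τ) * modeIntegral μ φ T + modeIntegral μ φ τ)
          + rot (-μ) τ * ((c - d * τ) * modeIntegral μ ψ T + modeIntegral μ ψ τ)
        rw [modeIntegral_add, modeIntegral_add]
        ring
      map_smul' := fun r φ => circle_ext fun τ => by
        change rot (-μ) τ * ((c - d * τ) * modeIntegral μ (r • φ) T + modeIntegral μ (r • φ) τ) =
          r • (rot (-μ) τ * ((c - d * τ) * modeIntegral μ φ T + modeIntegral μ φ τ))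
        simp only [modeIntegral_smul, Complex.real_smul]
        ring }
    ((‖c‖ + ‖d‖ * T) * T + T) fun φ => by
      have hT0 : 0 < T := hT.out
      refine circle_norm_le (by positivity) fun τ hτ => ?_
      have h1 := norm_modeIntegral_le μ φ ⟨hT0.le, le_rfl⟩
      have h2 := norm_modeIntegral_le μ φ hτ
      have h3 : ‖c - d * τ‖ ≤ ‖c‖ + ‖d‖ * T := by
        refine (norm_sub_le _ _).trans (add_le_add le_rfl ?_)
        rw [norm_mul, Complex.norm_real, Real.norm_of_nonneg hτ.1]
        exact mul_le_mul_of_nonneg_left hτ.2 (norm_nonneg _)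
      change ‖rot (-μ) τ * ((c - d * τ) * modeIntegral μ φ T + modeIntegral μ φ τ)‖ ≤ _
      rw [norm_mul, norm_rot, one_mul, add_mul, mul_assoc]
      refine (norm_add_le _ _).trans (add_le_add ?_ h2)
      rw [norm_mul]
      exact mul_le_mul h3 h1 (norm_nonneg _) (by positivity)

/-- Variation of constants. The drift -dτ, inserted to restore periodicity, leaves a defect that
vanishes when d = 0 or when the resonant average of φ is zero. -/
theorem hasDerivAt_oscillator (μ : ℝ) {c d : ℂ} (hd : d * (rot μ T - 1) = 0)
    (hc : c + 1 - d * T = rot μ T * c) (φ : C(AddCircle T, ℂ)) (τ : ℝ) :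
    HasDerivAt (fun τ : ℝ => oscillator μ hd hc φ τ)
      (-(μ * Complex.I) * oscillator μ hd hc φ τ + φ τ - d * modeAverage T μ φ * rot (-μ) τ) τ := by
  have h1 : HasDerivAt (fun τ : ℝ => c - d * τ) (-d) τ := by
    simpa using ((hasDerivAt_id τ).ofReal_comp.const_mul d).const_sub c
  have h := (hasDerivAt_rot (-μ) τ).mul
    ((h1.mul_const (modeIntegral μ φ T)).add (hasDerivAt_modeIntegral μ φ τ))
  refine h.congr_deriv ?_
  change _ = -(μ * Complex.I) *
    (rot (-μ) τ * ((c - d * τ) * modeIntegral μ φ T + modeIntegral μ φ τ)) + φ τ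
      - d * modeIntegral μ φ T * rot (-μ) τ
  simp only [Pi.add_apply]
  push_cast
  linear_combination (φ τ) * rot_neg_mul μ τ

end Oscillator

/-! ### Periodic solutions of one resonant and one nonresonant oscillator -/

section TwoModes

variable {T : ℝ}

/-- The periodic orbits `τ ↦ (a exp (-i ω τ), 0)` of the unperturbed two-mode system. -/
def resonantOrbit {ω : ℝ} (hω : rot ω T = 1) : ℂ →L[ℝ] C(AddCircle T, ℂ × ℂ) :=
  ((ContinuousLinearMap.id ℂ ℂ).smulRight (periodicLift (fun τ => (rot (-ω) τ, (0 : ℂ)))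
    ((continuous_rot _).prodMk continuous_const) fun τ => by
      have h := rot_neg_mul ω T
      rw [hω, mul_one] at h
      simp [rot_add, h])).restrictScalars ℝ

theorem resonantOrbit_coe {ω : ℝ} (hω : rot ω T = 1) (a : ℂ) (τ : ℝ) :
    resonantOrbit hω a (τ : AddCircle T) = (a * rot (-ω) τ, 0) := by
  change a • ((rot (-ω) τ, 0) : ℂ × ℂ) = _
  simp

variable [hT : Fact (0 < T)]

/-- Periodic solutions of a perturbed pair of oscillators, one resonant and one not, which
bifurcate from a nondegenerate zero of the averaged amplitude equation. -/
theorem exists_periodic_two_modes {ω ν : ℝ} (hω : rot ω T = 1) (hν : rot ν T ≠ 1)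
    {G : ℝ × (ℂ × ℂ) → ℂ × ℂ} (hG : ContDiff ℝ 1 G) (hp : ∀ τ v, G (τ + T, v) = G (τ, v))
    {a₀ : ℂ} (h₀ : ∫ s in (0 : ℝ)..T, rot ω s * (G (s, (a₀ * rot (-ω) s, 0))).1 = 0)
    (hinj : ∀ Γ' : ℂ →L[ℝ] ℂ,
      HasFDerivAt (fun a : ℂ => ∫ s in (0 : ℝ)..T, rot ω s * (G (s, (a * rot (-ω) s, 0))).1)
        Γ' a₀ → Function.Injective Γ') :
    ∃ (δ : ℝ) (x : ℝ → C(AddCircle T, ℂ × ℂ)), 0 < δ ∧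
      (∀ ε, |ε| < δ → ∀ τ : ℝ,
        HasDerivAt (fun τ : ℝ => (x ε τ).1)
          (-(ω * Complex.I) * (x ε τ).1 + ε * (G (τ, x ε τ)).1) τ ∧
        HasDerivAt (fun τ : ℝ => (x ε τ).2)
          (-(ν * Complex.I) * (x ε τ).2 + ε * (G (τ, x ε τ)).2) τ) ∧
      Tendsto x (𝓝 0) (𝓝 (resonantOrbit hω a₀)) := by
  have hT0 : (T : ℂ) ≠ 0 := by exact_mod_cast hT.out.ne'
  have hν' : rot ν T - 1 ≠ 0 := sub_ne_zero.2 hν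
  have hd₁ : (T : ℂ)⁻¹ * (rot ω T - 1) = 0 := by rw [hω]; simp
  have hc₁ : (0 : ℂ) + 1 - (T : ℂ)⁻¹ * T = rot ω T * 0 := by field_simp; simp
  have hd₂ : (0 : ℂ) * (rot ν T - 1) = 0 := zero_mul _
  have hc₂ : (rot ν T - 1)⁻¹ + 1 - (0 : ℂ) * T = rot ν T * (rot ν T - 1)⁻¹ := by
    field_simp; ring
  let S₁ := oscillator (T := T) ω hd₁ hc₁
  let S₂ := oscillator (T := T) ν hd₂ hc₂
  let π₁ := (ContinuousLinearMap.fst ℝ ℂ ℂ).compLeftContinuous ℝ (AddCircle T)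
  let π₂ := (ContinuousLinearMap.snd ℝ ℂ ℂ).compLeftContinuous ℝ (AddCircle T)
  let j₁ := (ContinuousLinearMap.inl ℝ ℂ ℂ).compLeftContinuous ℝ (AddCircle T)
  let j₂ := (ContinuousLinearMap.inr ℝ ℂ ℂ).compLeftContinuous ℝ (AddCircle T)
  let K : C(AddCircle T, ℂ × ℂ) →L[ℝ] C(AddCircle T, ℂ × ℂ) :=
    j₁ ∘L S₁ ∘L π₁ + j₂ ∘L S₂ ∘L π₂
  let P : C(AddCircle T, ℂ × ℂ) →L[ℝ] ℂ := modeAverage T ω ∘L π₁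
  let ι := resonantOrbit (T := T) hω
  let N := superposition (T := T) G hG.continuous hp
  obtain ⟨N', hN⟩ := hasStrictFDerivAt_superposition hG hp (ι a₀)
  have hΓ : (fun a : ℂ => ∫ s in (0 : ℝ)..T, rot ω s * (G (s, (a * rot (-ω) s, 0))).1) =
      fun a => P (N (ι a)) := by
    funext a
    simp only [← resonantOrbit_coe hω]
    rfl
  have hΓ' : HasFDerivAt (fun a => P (N (ι a))) (P ∘L N' ∘L ι) a₀ :=
    P.hasFDerivAt.comp a₀ (hN.hasFDerivAt.comp a₀ ι.hasFDerivAt)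
  -- The chain rule provides a derivative of the averaged map, so no formula for `N'` is needed.
  -- Injectivity is enough for an equivalence because ℂ has finite dimension over ℝ.
  have hi : Function.Injective (P ∘L N' ∘L ι) := hinj _ (by rwa [hΓ])
  let e : ℂ ≃L[ℝ] ℂ := (LinearEquiv.ofInjectiveEndo
    ((P ∘L N' ∘L ι : ℂ →L[ℝ] ℂ) : ℂ →ₗ[ℝ] ℂ) hi).toContinuousLinearEquiv
  obtain ⟨δ, a, x, hδ, hx, hlim⟩ := exists_branch ι K P hN
    ((congrFun hΓ a₀).symm.trans h₀) e fun a => rfl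
  refine ⟨δ, x, hδ, fun ε hε τ => ?_, hlim⟩
  obtain ⟨hx1, hx2⟩ := hx ε hε
  have hval : ∀ τ : ℝ, x ε τ =
      (a ε * rot (-ω) τ + ε * S₁ (π₁ (N (x ε))) τ, ε * S₂ (π₂ (N (x ε))) τ) := fun τ => by
    have h : x ε (τ : AddCircle T) = ι (a ε) (τ : AddCircle T) +
        ε • ((S₁ (π₁ (N (x ε))) τ, 0) + (0, S₂ (π₂ (N (x ε))) τ) : ℂ × ℂ) :=
      congrArg (fun y : C(AddCircle T, ℂ × ℂ) => y τ) hx1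
    rw [h, resonantOrbit_coe]
    simp
  have h1 := ((hasDerivAt_rot (-ω) τ).const_mul (a ε)).add
    ((hasDerivAt_oscillator ω hd₁ hc₁ (π₁ (N (x ε))) τ).const_mul (ε : ℂ))
  have h2 := (hasDerivAt_oscillator ν hd₂ hc₂ (π₂ (N (x ε))) τ).const_mul (ε : ℂ)
  -- The bifurcation equation removes the defect of `S₁`; that of `S₂` is zero because its d is 0.
  -- Thus the full equations hold, not just their projections.
  have hP : modeAverage T ω (π₁ (N (x ε))) = 0 := hx2
  have hN1 : π₁ (N (x ε)) (τ : AddCircle T) = (G (τ, x ε τ)).1 := rfl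
  have hN2 : π₂ (N (x ε)) (τ : AddCircle T) = (G (τ, x ε τ)).2 := rfl
  constructor
  · have hfun : (fun τ : ℝ => (x ε τ).1) = fun τ : ℝ =>
        a ε * rot (-ω) τ + ε * S₁ (π₁ (N (x ε))) τ := funext fun τ => by rw [hval τ]
    rw [hfun]
    refine h1.congr_deriv ?_
    rw [hP, hN1, show (x ε τ).1 = _ from congrFun hfun τ]
    push_cast
    ring
  · have hfun : (fun τ : ℝ => (x ε τ).2) = fun τ : ℝ =>
        ε * S₂ (π₂ (N (x ε))) τ := funext fun τ => by rw [hval τ]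
    rw [hfun]
    refine h2.congr_deriv ?_
    rw [hN2, show (x ε τ).2 = _ from congrFun hfun τ]
    ring

end TwoModes

/-! ### The two frequencies of the pendulum -/

/-- Angular frequency `√(2 - √2)` of the slow mode. -/
def omegaSlow : ℝ := Real.sqrt (2 - Real.sqrt 2)

theorem sqrt_two_lt_two : Real.sqrt 2 < 2 := by
  rw [Real.sqrt_lt' two_pos]; norm_num

theorem omegaFast_pos : 0 < omegaFast := Real.sqrt_pos.2 (by positivity)

theorem omegaFast_sq : omegaFast ^ 2 = 2 + Real.sqrt 2 := Real.sq_sqrt (by positivity)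

theorem omegaSlow_pos : 0 < omegaSlow := Real.sqrt_pos.2 (sub_pos.2 sqrt_two_lt_two)

theorem omegaSlow_sq : omegaSlow ^ 2 = 2 - Real.sqrt 2 :=
  Real.sq_sqrt (sub_nonneg.2 sqrt_two_lt_two.le)

theorem sqrt_four_add : Real.sqrt (4 + 2 * Real.sqrt 2) = Real.sqrt 2 * omegaFast := by
  rw [omegaFast, ← Real.sqrt_mul zero_le_two]
  congr 1
  ring

theorem periodFast_pos : 0 < periodFast := div_pos (by positivity) omegaFast_pos

theorem rot_omegaFast_period (p : ℕ) : rot omegaFast (p * periodFast) = 1 := by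
  have h : omegaFast * (p * periodFast) = p * (2 * Real.pi) := by
    have := omegaFast_pos.ne'
    rw [periodFast]
    field_simp
  rw [rot, h]
  push_cast
  rw [mul_assoc]
  exact Complex.exp_nat_mul_two_pi_mul_I p

/-- The two frequencies are incommensurable, so the slow mode is not resonant. -/
theorem rot_omegaSlow_period_ne_one {p : ℕ} (hp : 0 < p) :
    rot omegaSlow (p * periodFast) ≠ 1 := by
  intro h
  obtain ⟨k, hk⟩ := Complex.exp_eq_one_iff.1 h
  have hω := omegaFast_pos.ne'
  have hp' : (p : ℝ) ≠ 0 := by positivity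
  have hk' : omegaSlow * (p * periodFast) = k * (2 * Real.pi) := by
    have h1 : ((omegaSlow * (p * periodFast) : ℝ) : ℂ) * Complex.I =
        ((k * (2 * Real.pi) : ℝ) : ℂ) * Complex.I := by rw [hk]; push_cast; ring
    exact_mod_cast mul_right_cancel₀ Complex.I_ne_zero h1
  have hk2 : omegaSlow * p = k * omegaFast := by
    rw [periodFast] at hk'
    field_simp at hk'
    linarith
  -- As ων = √2, the ratio is ν/ω = √2/(2 + √2) = √2 - 1. Resonance, νp = kω, would make √2 = k/p +
  -- 1 rational.
  have hratio : omegaSlow = (Real.sqrt 2 - 1) * omegaFast := by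
    have h2 : Real.sqrt 2 ^ 2 = 2 := Real.sq_sqrt zero_le_two
    have h1 : 1 ≤ Real.sqrt 2 := Real.one_le_sqrt.2 one_le_two
    refine (sq_eq_sq₀ omegaSlow_pos.le (mul_nonneg (by linarith) omegaFast_pos.le)).1 ?_
    rw [mul_pow, omegaSlow_sq, omegaFast_sq]
    linear_combination (-Real.sqrt 2) * h2
  have h3 : Real.sqrt 2 = ((k / p + 1 : ℚ) : ℝ) := by
    rw [hratio] at hk2
    have : (Real.sqrt 2 - 1) * p = k := mul_right_cancel₀ hω (by linarith)
    push_cast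
    field_simp
    linarith
  exact irrational_sqrt_two ⟨_, h3.symm⟩

/-! ### Normal mode coordinates -/

/-- First angle in terms of the complex mode amplitudes. -/
def angleFst : ℂ × ℂ →L[ℝ] ℝ :=
  (Real.sqrt 2 * omegaSlow)⁻¹ • (Complex.reCLM ∘L ContinuousLinearMap.snd ℝ ℂ ℂ) -
    (Real.sqrt 2 * omegaFast)⁻¹ • (Complex.reCLM ∘L ContinuousLinearMap.fst ℝ ℂ ℂ)

/-- First velocity in terms of the complex mode amplitudes. -/
def velocityFst : ℂ × ℂ →L[ℝ] ℝ :=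
  (Real.sqrt 2)⁻¹ • (Complex.imCLM ∘L ContinuousLinearMap.snd ℝ ℂ ℂ) -
    (Real.sqrt 2)⁻¹ • (Complex.imCLM ∘L ContinuousLinearMap.fst ℝ ℂ ℂ)

/-- Second angle in terms of the complex mode amplitudes. -/
def angleSnd : ℂ × ℂ →L[ℝ] ℝ :=
  omegaSlow⁻¹ • (Complex.reCLM ∘L ContinuousLinearMap.snd ℝ ℂ ℂ) +
    omegaFast⁻¹ • (Complex.reCLM ∘L ContinuousLinearMap.fst ℝ ℂ ℂ)

/-- Second velocity in terms of the complex mode amplitudes. -/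
def velocitySnd : ℂ × ℂ →L[ℝ] ℝ :=
  (Complex.imCLM ∘L ContinuousLinearMap.snd ℝ ℂ ℂ) +
    (Complex.imCLM ∘L ContinuousLinearMap.fst ℝ ℂ ℂ)

theorem angleFst_apply (z : ℂ × ℂ) :
    angleFst z = (Real.sqrt 2 * omegaSlow)⁻¹ * z.2.re - (Real.sqrt 2 * omegaFast)⁻¹ * z.1.re :=
  rfl

theorem velocityFst_apply (z : ℂ × ℂ) :
    velocityFst z = (Real.sqrt 2)⁻¹ * z.2.im - (Real.sqrt 2)⁻¹ * z.1.im :=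
  rfl

theorem angleSnd_apply (z : ℂ × ℂ) :
    angleSnd z = omegaSlow⁻¹ * z.2.re + omegaFast⁻¹ * z.1.re :=
  rfl

theorem velocitySnd_apply (z : ℂ × ℂ) : velocitySnd z = z.2.im + z.1.im :=
  rfl

/-- A perturbation as a function of time and the mode amplitudes. -/
def inModes (F : ℝ × ℝ × ℝ × ℝ × ℝ → ℝ) (w : ℝ × (ℂ × ℂ)) : ℝ :=
  F (w.1, angleFst w.2, velocityFst w.2, angleSnd w.2, velocitySnd w.2)

theorem contDiff_inModes {F : ℝ × ℝ × ℝ × ℝ × ℝ → ℝ} (hF : ContDiff ℝ 2 F) :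
    ContDiff ℝ 1 (inModes F) :=
  (hF.of_le one_le_two).comp (contDiff_fst.prodMk
    ((angleFst.contDiff.comp contDiff_snd).prodMk
      ((velocityFst.contDiff.comp contDiff_snd).prodMk
        ((angleSnd.contDiff.comp contDiff_snd).prodMk
          (velocitySnd.contDiff.comp contDiff_snd)))))

/-- The forcing of the two complex mode amplitudes. -/
def modeForcing (F₁ F₂ : ℝ × ℝ × ℝ × ℝ × ℝ → ℝ) (w : ℝ × (ℂ × ℂ)) : ℂ × ℂ :=
  (Complex.I / 2 * (-Real.sqrt 2 * inModes F₁ w + inModes F₂ w : ℝ),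
   Complex.I / 2 * (Real.sqrt 2 * inModes F₁ w + inModes F₂ w : ℝ))

theorem contDiff_modeForcing {F₁ F₂ : ℝ × ℝ × ℝ × ℝ × ℝ → ℝ} (hF₁ : ContDiff ℝ 2 F₁)
    (hF₂ : ContDiff ℝ 2 F₂) : ContDiff ℝ 1 (modeForcing F₁ F₂) := by
  have h₁ := contDiff_inModes hF₁
  have h₂ := contDiff_inModes hF₂
  exact (contDiff_const.mul
    (Complex.ofRealCLM.contDiff.comp ((contDiff_const.mul h₁).add h₂))).prodMk
    (contDiff_const.mul (Complex.ofRealCLM.contDiff.comp ((contDiff_const.mul h₁).add h₂)))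

/-- Solutions of the mode equations are solutions of the perturbed double pendulum. -/
theorem isSolution_of_modes {F₁ F₂ : ℝ × ℝ × ℝ × ℝ × ℝ → ℝ} {ε : ℝ} {z : ℝ → ℂ × ℂ}
    (h₁ : ∀ τ, HasDerivAt (fun τ => (z τ).1)
      (-(omegaFast * Complex.I) * (z τ).1 + ε * (modeForcing F₁ F₂ (τ, z τ)).1) τ)
    (h₂ : ∀ τ, HasDerivAt (fun τ => (z τ).2)
      (-(omegaSlow * Complex.I) * (z τ).2 + ε * (modeForcing F₁ F₂ (τ, z τ)).2) τ) :
    IsSolution F₁ F₂ ε (fun τ => angleFst (z τ)) (fun τ => angleSnd (z τ)) ∧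
      deriv (fun τ => angleFst (z τ)) = (fun τ => velocityFst (z τ)) ∧
      deriv (fun τ => angleSnd (z τ)) = fun τ => velocitySnd (z τ) := by
  have hω := omegaFast_pos.ne'
  have hν := omegaSlow_pos.ne'
  have hr : Real.sqrt 2 ≠ 0 := by positivity
  have hr2 : Real.sqrt 2 ^ 2 = 2 := Real.sq_sqrt zero_le_two
  have hω2 := omegaFast_sq
  have hν2 := omegaSlow_sq
  have hz : ∀ τ, HasDerivAt z
      (-(omegaFast * Complex.I) * (z τ).1 + ε * (modeForcing F₁ F₂ (τ, z τ)).1,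
       -(omegaSlow * Complex.I) * (z τ).2 + ε * (modeForcing F₁ F₂ (τ, z τ)).2) τ :=
    fun τ => (h₁ τ).prodMk (h₂ τ)
  have hL : ∀ (L : ℂ × ℂ →L[ℝ] ℝ) τ, HasDerivAt (fun τ => L (z τ)) _ τ :=
    fun L τ => L.hasFDerivAt.comp_hasDerivAt τ (hz τ)
  -- The forcing of each amplitude is purely imaginary, so it does not enter the derivatives of the
  -- angles, which involve real parts only.
  have hd₁ : ∀ τ, HasDerivAt (fun τ => angleFst (z τ)) (velocityFst (z τ)) τ := fun τ => by
    refine (hL angleFst τ).congr_deriv ?_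
    simp [angleFst_apply, velocityFst_apply, modeForcing]
    field_simp
  have hd₂ : ∀ τ, HasDerivAt (fun τ => angleSnd (z τ)) (velocitySnd (z τ)) τ := fun τ => by
    refine (hL angleSnd τ).congr_deriv ?_
    simp [angleSnd_apply, velocitySnd_apply, modeForcing]
    field_simp
  have he₁ := funext fun τ => (hd₁ τ).deriv
  have he₂ := funext fun τ => (hd₂ τ).deriv
  refine ⟨⟨fun τ => (hd₁ τ).differentiableAt, fun τ => (hd₂ τ).differentiableAt, ?_, ?_⟩, he₁, he₂⟩
  · intro τ
    rw [he₁, he₂]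
    refine (hL velocityFst τ).congr_deriv ?_
    change _ = -2 * angleFst (z τ) + angleSnd (z τ) + ε * inModes F₁ (τ, z τ)
    simp [angleFst_apply, angleSnd_apply, velocityFst_apply, modeForcing]
    field_simp
    -- The columns (∓1/√2, 1) are eigenvectors of the stiffness matrix for ω² and ν². The rows (∓√2,
    -- 1)/2 in `modeForcing` are dual to them, so the forcing recombines to F₁ and F₂.
    linear_combination (-2 * omegaFast * (z τ).2.re) * hν2 + (2 * omegaSlow * (z τ).1.re) * hω2
  · intro τ
    rw [he₁, he₂]
    refine (hL velocitySnd τ).congr_deriv ?_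
    change _ = 2 * angleFst (z τ) - 2 * angleSnd (z τ) + ε * inModes F₂ (τ, z τ)
    simp [angleFst_apply, angleSnd_apply, velocitySnd_apply, modeForcing]
    field_simp
    linear_combination (-2 * Real.sqrt 2 * omegaFast * (z τ).2.re) * hν2 +
      (-2 * Real.sqrt 2 * omegaSlow * (z τ).1.re) * hω2 +
      (2 * omegaFast * (z τ).2.re - 2 * omegaSlow * (z τ).1.re) * hr2

/-- The amplitude of the fast-mode orbit with parameters `(Z, W)`. -/
def fastAmplitude (x : ℝ × ℝ) : ℂ := Complex.equivRealProdCLM.symm x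

theorem fastAmplitude_mul_rot_re (x : ℝ × ℝ) (τ : ℝ) :
    (fastAmplitude x * rot (-omegaFast) τ).re =
      x.1 * Real.cos (omegaFast * τ) + x.2 * Real.sin (omegaFast * τ) := by
  simp [fastAmplitude, rot_re, rot_im]

theorem fastAmplitude_mul_rot_im (x : ℝ × ℝ) (τ : ℝ) :
    (fastAmplitude x * rot (-omegaFast) τ).im =
      x.2 * Real.cos (omegaFast * τ) - x.1 * Real.sin (omegaFast * τ) := by
  simp [fastAmplitude, rot_re, rot_im]
  ring

theorem angleFst_fast (x : ℝ × ℝ) (τ : ℝ) :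
    angleFst (fastAmplitude x * rot (-omegaFast) τ, 0) = fastA x.1 x.2 τ := by
  simp only [angleFst_apply, fastAmplitude_mul_rot_re, Complex.zero_re, fastA, sqrt_four_add]
  ring

theorem velocityFst_fast (x : ℝ × ℝ) (τ : ℝ) :
    velocityFst (fastAmplitude x * rot (-omegaFast) τ, 0) = fastB x.1 x.2 τ := by
  simp only [velocityFst_apply, fastAmplitude_mul_rot_im, Complex.zero_im, fastB]
  ring

theorem angleSnd_fast (x : ℝ × ℝ) (τ : ℝ) :
    angleSnd (fastAmplitude x * rot (-omegaFast) τ, 0) = fastC x.1 x.2 τ := by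
  simp only [angleSnd_apply, fastAmplitude_mul_rot_re, Complex.zero_re, fastC]
  ring

theorem velocitySnd_fast (x : ℝ × ℝ) (τ : ℝ) :
    velocitySnd (fastAmplitude x * rot (-omegaFast) τ, 0) = fastD x.1 x.2 τ := by
  simp only [velocitySnd_apply, fastAmplitude_mul_rot_im, Complex.zero_im, fastD]
  ring

theorem inModes_fast (F : ℝ × ℝ × ℝ × ℝ × ℝ → ℝ) (x : ℝ × ℝ) (τ : ℝ) :
    inModes F (τ, fastAmplitude x * rot (-omegaFast) τ, 0) = alongFast F x.1 x.2 τ := by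
  simp only [inModes, alongFast, angleFst_fast, velocityFst_fast, angleSnd_fast, velocitySnd_fast]

/-- The fast-mode orbits solve the unperturbed system. -/
theorem isSolution_fast (F₁ F₂ : ℝ × ℝ × ℝ × ℝ × ℝ → ℝ) (Z W : ℝ) :
    IsSolution F₁ F₂ 0 (fastA Z W) (fastC Z W) := by
  have h := (isSolution_of_modes (F₁ := F₁) (F₂ := F₂) (ε := 0)
    (z := fun τ => (fastAmplitude (Z, W) * rot (-omegaFast) τ, 0)) (fun τ => by
      refine ((hasDerivAt_rot (-omegaFast) τ).const_mul (fastAmplitude (Z, W))).congr_deriv ?_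
      push_cast
      ring) fun τ => by simpa using hasDerivAt_const τ (0 : ℂ)).1
  simpa only [angleFst_fast, angleSnd_fast] using h

theorem omegaFast_mul_add_period (τ : ℝ) :
    omegaFast * (τ + periodFast) = omegaFast * τ + 2 * Real.pi := by
  have := omegaFast_pos.ne'
  rw [periodFast]
  field_simp

theorem periodic_fastA (Z W : ℝ) : Function.Periodic (fastA Z W) periodFast := fun τ => by
  simp [fastA, omegaFast_mul_add_period]

theorem periodic_fastC (Z W : ℝ) : Function.Periodic (fastC Z W) periodFast := fun τ => by
  simp [fastC, omegaFast_mul_add_period]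

/-! ### Identification of the averaged map and the resulting branches -/

/-- The averaged amplitude equation of the fast mode. -/
def averagedModes (F₁ F₂ : ℝ × ℝ × ℝ × ℝ × ℝ → ℝ) (T : ℝ) (a : ℂ) : ℂ :=
  ∫ s in (0 : ℝ)..T, rot omegaFast s * (modeForcing F₁ F₂ (s, (a * rot (-omegaFast) s, 0))).1

/-- The factor i/2 in the forcing turns e^{iωs} into (-sin ωs + i cos ωs)/2. The real and imaginary
parts of the amplitude equation are therefore -𝒢¹/2 and 𝒢²/2. -/
theorem averaged_eq {F₁ F₂ : ℝ × ℝ × ℝ × ℝ × ℝ → ℝ} (hF₁ : ContDiff ℝ 2 F₁)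
    (hF₂ : ContDiff ℝ 2 F₂) (p : ℕ) (x : ℝ × ℝ) :
    averaged F₁ F₂ p x =
      (((-2 : ℝ) • Complex.reCLM).prod ((2 : ℝ) • Complex.imCLM))
        (averagedModes F₁ F₂ (p * periodFast) (fastAmplitude x)) := by
  have hcont : Continuous fun s : ℝ => rot omegaFast s *
      (modeForcing F₁ F₂ (s, (fastAmplitude x * rot (-omegaFast) s, 0))).1 := by
    have h := (contDiff_modeForcing hF₁ hF₂).continuous
    exact (continuous_rot _).mul (continuous_fst.comp (h.comp (by fun_prop)))
  have hint := hcont.intervalIntegrable (μ := MeasureTheory.volume) 0 (p * periodFast)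
  refine Prod.ext ?_ ?_
  · change _ = ((-2 : ℝ) • Complex.reCLM) (averagedModes F₁ F₂ (p * periodFast) (fastAmplitude x))
    rw [averagedModes, ← ContinuousLinearMap.intervalIntegral_comp_comm _ hint]
    refine intervalIntegral.integral_congr fun s _ => ?_
    simp [modeForcing, inModes_fast, rot_re, rot_im]
    ring
  · change _ = ((2 : ℝ) • Complex.imCLM) (averagedModes F₁ F₂ (p * periodFast) (fastAmplitude x))
    rw [averagedModes, ← ContinuousLinearMap.intervalIntegral_comp_comm _ hint]
    refine intervalIntegral.integral_congr fun s _ => ?_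
    simp [modeForcing, inModes_fast, rot_re, rot_im]
    ring

/-- Needed because velocities agree with derivatives of angles only for small ε, and because the
final families are glued from two branches. -/
theorem tendstoUniformly_of_eventually_eq {F F' : ℝ → ℝ → ℝ} {f : ℝ → ℝ} {l l' : Filter ℝ}
    (h : TendstoUniformly F f l) (hle : l' ≤ l) (he : ∀ᶠ ε in l', F ε = F' ε) :
    TendstoUniformly F' f l' := fun u hu => by
  filter_upwards [hle (h u hu), he] with ε h₁ h₂
  rwa [← h₂]

/-- A branch of periodic solutions emanates from every simple zero of the averaged map. -/
theorem exists_periodic_of_isSimpleZero {F₁ F₂ : ℝ × ℝ × ℝ × ℝ × ℝ → ℝ}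
    (hF₁ : ContDiff ℝ 2 F₁) (hF₂ : ContDiff ℝ 2 F₂) {p : ℕ} (hp : 0 < p)
    (hper₁ : ∀ τ x y z w : ℝ, F₁ (τ + p * periodFast, x, y, z, w) = F₁ (τ, x, y, z, w))
    (hper₂ : ∀ τ x y z w : ℝ, F₂ (τ + p * periodFast, x, y, z, w) = F₂ (τ, x, y, z, w))
    {Z W : ℝ} (hzero : IsSimpleZero (averaged F₁ F₂ p) (Z, W)) :
    ∃ (δ : ℝ) (θ₁ θ₂ : ℝ → ℝ → ℝ), 0 < δ ∧
      (∀ ε : ℝ, |ε| < δ → IsSolution F₁ F₂ ε (θ₁ ε) (θ₂ ε) ∧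
        Function.Periodic (θ₁ ε) (p * periodFast) ∧ Function.Periodic (θ₂ ε) (p * periodFast)) ∧
      TendstoUniformly θ₁ (fastA Z W) (𝓝 0) ∧
      TendstoUniformly (fun ε => deriv (θ₁ ε)) (fastB Z W) (𝓝 0) ∧
      TendstoUniformly θ₂ (fastC Z W) (𝓝 0) ∧
      TendstoUniformly (fun ε => deriv (θ₂ ε)) (fastD Z W) (𝓝 0) := by
  obtain ⟨h0, -, hdet⟩ := hzero
  have : Fact (0 < p * periodFast) :=
    ⟨mul_pos (Nat.cast_pos.2 hp) periodFast_pos⟩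
  have hav := funext (averaged_eq hF₁ hF₂ p)
  have hG0 : averagedModes F₁ F₂ (p * periodFast) (fastAmplitude (Z, W)) = 0 := by
    rw [hav] at h0
    have h1 := congrArg Prod.fst h0
    have h2 := congrArg Prod.snd h0
    apply Complex.ext
    · simpa using h1
    · simpa using h2
  obtain ⟨δ, x, hδ, hsol, hlim⟩ := exists_periodic_two_modes (T := p * periodFast)
    (rot_omegaFast_period p) (rot_omegaSlow_period_ne_one hp) (contDiff_modeForcing hF₁ hF₂)
    (fun τ v => by simp only [modeForcing, inModes, hper₁, hper₂]) hG0 (fun Γ' hΓ' a b hab => by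
      -- `D` factors through Γ' between linear isomorphisms. It is the derivative of the averaged
      -- map, so its nonzero determinant forces Γ' to be injective.
      let D : ℝ × ℝ →L[ℝ] ℝ × ℝ := ((-2 : ℝ) • Complex.reCLM).prod ((2 : ℝ) • Complex.imCLM) ∘L
        Γ' ∘L (Complex.equivRealProdCLM.symm : ℝ × ℝ →L[ℝ] ℂ)
      have hd : HasFDerivAt (averaged F₁ F₂ p) D (Z, W) := by
        rw [hav]
        exact (((-2 : ℝ) • Complex.reCLM).prod ((2 : ℝ) • Complex.imCLM)).hasFDerivAt.comp (Z, W)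
          (HasFDerivAt.comp (Z, W) (f := fastAmplitude) hΓ'
            Complex.equivRealProdCLM.symm.hasFDerivAt)
      rw [hd.fderiv] at hdet
      have hinj := (LinearMap.equivOfDetNeZero (D : ℝ × ℝ →ₗ[ℝ] ℝ × ℝ) hdet).injective
      have h := @hinj (Complex.equivRealProdCLM a) (Complex.equivRealProdCLM b) (by
        change (((-2 : ℝ) • Complex.reCLM).prod ((2 : ℝ) • Complex.imCLM))
            (Γ' (Complex.equivRealProdCLM.symm (Complex.equivRealProdCLM a))) =
          (((-2 : ℝ) • Complex.reCLM).prod ((2 : ℝ) • Complex.imCLM))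
            (Γ' (Complex.equivRealProdCLM.symm (Complex.equivRealProdCLM b)))
        rw [ContinuousLinearEquiv.symm_apply_apply, ContinuousLinearEquiv.symm_apply_apply, hab])
      exact Complex.equivRealProdCLM.injective h)
  have hmodes := fun ε hε => isSolution_of_modes (z := fun τ => x ε τ)
    (fun τ => (hsol ε hε τ).1) (fun τ => (hsol ε hε τ).2)
  have hunif : ∀ L : ℂ × ℂ →L[ℝ] ℝ, TendstoUniformly (fun ε (τ : ℝ) => L (x ε τ))
      (fun τ : ℝ => L (fastAmplitude (Z, W) * rot (-omegaFast) τ, 0)) (𝓝 0) := fun L => by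
    have h := L.uniformContinuous.comp_tendstoUniformly
      ((ContinuousMap.tendsto_iff_tendstoUniformly.1 hlim).comp
        ((↑) : ℝ → AddCircle (p * periodFast)))
    simpa only [Function.comp_def, resonantOrbit_coe] using h
  have hsmall : ∀ᶠ ε : ℝ in 𝓝 0, |ε| < δ :=
    (continuous_abs.tendsto' 0 0 abs_zero).eventually_lt_const hδ
  refine ⟨δ, fun ε τ => angleFst (x ε τ), fun ε τ => angleSnd (x ε τ), hδ, fun ε hε =>
    ⟨(hmodes ε hε).1, fun τ => by simp, fun τ => by simp⟩, ?_, ?_, ?_, ?_⟩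
  · simpa only [angleFst_fast] using hunif angleFst
  · have h := hunif velocityFst
    simp only [velocityFst_fast] at h
    exact tendstoUniformly_of_eventually_eq h le_rfl
      (hsmall.mono fun ε hε => (hmodes ε hε).2.1.symm)
  · simpa only [angleSnd_fast] using hunif angleSnd
  · have h := hunif velocitySnd
    simp only [velocitySnd_fast] at h
    exact tendstoUniformly_of_eventually_eq h le_rfl
      (hsmall.mono fun ε hε => (hmodes ε hε).2.2.symm)

end DoublePendulum

end

theorem theorem2 (F₁ F₂ : ℝ × ℝ × ℝ × ℝ × ℝ → ℝ)
    (hF₁ : ContDiff ℝ 2 F₁) (hF₂ : ContDiff ℝ 2 F₂)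
    (p q : ℕ) (hp : 0 < p) (hq : 0 < q) (hpq : Nat.Coprime p q)
    (hper₁ : ∀ τ x y z w : ℝ,
      F₁ (τ + p * DoublePendulum.periodFast / q, x, y, z, w) = F₁ (τ, x, y, z, w))
    (hper₂ : ∀ τ x y z w : ℝ,
      F₂ (τ + p * DoublePendulum.periodFast / q, x, y, z, w) = F₂ (τ, x, y, z, w)) :
    ∃ ε₀ : ℝ, 0 < ε₀ ∧ ∀ Z W : ℝ, (Z, W) ≠ (0, 0) →
      DoublePendulum.IsSimpleZero (DoublePendulum.averaged F₁ F₂ p) (Z, W) →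
      -- the limit is a `T₂`-periodic solution of the unperturbed system
      (DoublePendulum.IsSolution F₁ F₂ 0
          (DoublePendulum.fastA Z W) (DoublePendulum.fastC Z W) ∧
        Function.Periodic (DoublePendulum.fastA Z W) DoublePendulum.periodFast ∧
        Function.Periodic (DoublePendulum.fastC Z W) DoublePendulum.periodFast) ∧
      ∃ θ₁ θ₂ : ℝ → ℝ → ℝ,
        -- `τ ↦ (θ₁ ε τ, θ₂ ε τ)` is a `p T₂`-periodic solution for all small `ε ≠ 0`
        (∀ ε : ℝ, ε ≠ 0 → |ε| < ε₀ →
          DoublePendulum.IsSolution F₁ F₂ ε (θ₁ ε) (θ₂ ε) ∧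
          Function.Periodic (θ₁ ε) (p * DoublePendulum.periodFast) ∧
          Function.Periodic (θ₂ ε) (p * DoublePendulum.periodFast)) ∧
        -- it tends to the fast-mode orbit in phase space, uniformly in time
        TendstoUniformly θ₁ (DoublePendulum.fastA Z W) (𝓝[≠] 0) ∧
        TendstoUniformly (fun ε => deriv (θ₁ ε)) (DoublePendulum.fastB Z W) (𝓝[≠] 0) ∧
        TendstoUniformly θ₂ (DoublePendulum.fastC Z W) (𝓝[≠] 0) ∧
        TendstoUniformly (fun ε => deriv (θ₂ ε)) (DoublePendulum.fastD Z W) (𝓝[≠] 0) := by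
  open DoublePendulum in
  have hperiod : ∀ F : ℝ × ℝ × ℝ × ℝ × ℝ → ℝ,
      (∀ τ x y z w : ℝ, F (τ + p * periodFast / q, x, y, z, w) = F (τ, x, y, z, w)) →
      ∀ τ x y z w : ℝ, F (τ + p * periodFast, x, y, z, w) = F (τ, x, y, z, w) := by
    intro F hF τ x y z w
    have h : Function.Periodic (fun τ => F (τ, x, y, z, w)) (p * periodFast / q) :=
      fun τ => hF τ x y z w
    have h' := h.nat_mul q τ
    rwa [mul_div_cancel₀ _ (Nat.cast_ne_zero.2 hq.ne')] at h'
  have branch := fun {Z W : ℝ} => DoublePendulum.exists_periodic_of_isSimpleZero hF₁ hF₂ hp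
    (hperiod F₁ hper₁) (hperiod F₂ hper₂) (Z := Z) (W := W)
  -- Solutions along the branch of one fixed zero make `ε₀` independent of the zero.
  by_cases hex : ∃ x, DoublePendulum.IsSimpleZero (DoublePendulum.averaged F₁ F₂ p) x
  · obtain ⟨x, hx⟩ := hex
    obtain ⟨ε₀, φ₁, φ₂, hε₀, hφ, -⟩ := branch hx
    refine ⟨ε₀, hε₀, fun Z W _ hZW => ⟨⟨DoublePendulum.isSolution_fast F₁ F₂ Z W,
      DoublePendulum.periodic_fastA Z W, DoublePendulum.periodic_fastC Z W⟩, ?_⟩⟩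
    obtain ⟨δ, θ₁, θ₂, hδ, hθ, hA, hB, hC, hD⟩ := branch hZW
    have hsmall : ∀ᶠ ε : ℝ in 𝓝[≠] 0, |ε| < δ :=
      nhdsWithin_le_nhds ((continuous_abs.tendsto' 0 0 abs_zero).eventually_lt_const hδ)
    have hle : 𝓝[≠] (0 : ℝ) ≤ 𝓝 0 := nhdsWithin_le_nhds
    -- The width δ depends on the zero and may be smaller than ε₀. For δ ≤ |ε| < ε₀ the statement
    -- asks only for some periodic solution, which the fixed branch φ supplies; the limits see only
    -- |ε| < δ.
    refine ⟨fun ε => if |ε| < δ then θ₁ ε else φ₁ ε, fun ε => if |ε| < δ then θ₂ ε else φ₂ ε,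
      fun ε _ hε => ?_, ?_, ?_, ?_, ?_⟩
    · by_cases h : |ε| < δ
      · simpa only [if_pos h] using hθ ε h
      · simpa only [if_neg h] using hφ ε hε
    · exact tendstoUniformly_of_eventually_eq hA hle
        (hsmall.mono fun ε h => by simp only [if_pos h])
    · exact tendstoUniformly_of_eventually_eq hB hle
        (hsmall.mono fun ε h => by simp only [if_pos h])
    · exact tendstoUniformly_of_eventually_eq hC hle
        (hsmall.mono fun ε h => by simp only [if_pos h])
    · exact tendstoUniformly_of_eventually_eq hD hle
        (hsmall.mono fun ε h => by simp only [if_pos h])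
  · exact ⟨1, one_pos, fun Z W _ hZW => absurd ⟨_, hZW⟩ hex⟩
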